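/- **Setting.** Let $G$ be an infinite group generated by a finite symmetric set $S$. Let $\mathcal M$ be the set of probability measures on $S$ and $\mathcal B$ the set of probability distributions $\mu=(\mu_k)_{k\ge 1}$ with $\sum_{k\ge1} k\mu_k<\infty$. Let $Q$ and $\widetilde Q$ be probability measures on $\mathcal M$ and $\mathcal B$, and let $\Theta$ be the product measure on $(\mathcal M\times\mathcal B)^G$ with one-dimensional marginal $Q\times\widetilde Q$; its realizations are the environments $(\omega,\mu)=(\omega_x,\mu_x)_{x\in G}$. Let $P_\omega$ be the Markov chain on $G$ with transition probabilities $p_\omega(x,y)=\omega_x(x^{-1}y)$ if $x^{-1}y\in S$ and $0$ otherwise. Assume that there are a set $S'\subseteq S$ generating $G$ and a $\gamma>0$ with $Q\{q: q(s)>\gamma\ \forall s\in S'\}=1$, and that $P_\omega$ is irreducible for $\Theta$-almost every $(\omega,\mu)$ (which is automatic if $S'$ generates $G$ as a semigroup). For an environment $(\omega,\mu)$ the branching Markov chain starts with one particle at $x$; in each time step every particle, at position $y$ say, is replaced by $k\ge1$ particles with probability $\mu_y(k)$, and each of these then moves independently according to $p_\omega(y,\cdot)$; all particles behave independently of each other and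 of the past. For $x_0\in G$ modify this process as follows: the first time step is unchanged, but from the second time step on every particle located at $x_0$ stays there forever and does not split. Let $\eta(n,x_0)$ be the number of particles at $x_0$ at time $n$ in the modified process, let $\nu(x_0)=\lim_{n\to\infty}\eta(n,x_0)\in\{0,1,\dots\}\cup\{\infty\}$, and let $\mathbb E_{\omega,\mu,x}\,\nu(x_0)$ be its expectation when the process starts with one particle at $x$. **Statement.** Exactly one of the following two cases holds: * for $\Theta$-almost every $(\omega,\mu)$: $\mathbb E_{\omega,\mu,x}\,\nu(x_0)<\infty$ for all $x,x_0\in G$; * for $\Theta$-almost every $(\omega,\mu)$: $\mathbb E_{\omega,\mu,x_0}\,\nu(x_0)=\infty$ for all $x_0\in G$. -/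

import Mathlib

open MeasureTheory ProbabilityTheory Filter
open scoped ENNReal

noncomputable section

namespace BRWRE

/-- Particle configurations `[x_1, ..., x_r]` (the list of the positions of the particles); all sets
of configurations are measurable. -/
instance instMeasurableSpaceConfig {X : Type*} : MeasurableSpace (List X) := ⊤

/-- The σ-algebra on probability vectors generated by the evaluations `p ↦ p a`. -/
instance instMeasurableSpacePMF {α : Type*} : MeasurableSpace (PMF α) :=
  MeasurableSpace.comap (fun (p : PMF α) (a : α) => p a) MeasurableSpace.pi

/-! ### Branching Markov chains -/

section BMC

variable {X : Type*}

/-- The `n`-step transition law `p^{(n)}(x, ·)` of the Markov chain with transition law `P`. -/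
def nStep (P : X → PMF X) : ℕ → X → PMF X
  | 0, x => PMF.pure x
  | n + 1, x => (P x).bind (nStep P n)

/-- The Markov chain is irreducible. -/
def IsIrreducible (P : X → PMF X) : Prop :=
  ∀ x y : X, ∃ n : ℕ, 0 < nStep P n x y

/-- The positions of `k` particles that move independently, each from its parent's position
according to the law `p`. -/
def moves (p : PMF X) : ℕ → PMF (List X)
  | 0 => PMF.pure []
  | k + 1 => p.bind fun y => (moves p k).bind fun l => PMF.pure (y :: l)

/-- The offspring of one particle at `x`: it splits into `k` particles with probability `μ_k(x)`,
`k ≥ 1`, and these move independently according to `P x`. -/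
def offspring (P : X → PMF X) (μ : X → PMF ℕ+) (x : X) : PMF (List X) :=
  (μ x).bind fun k => moves (P x) (k : ℕ)

/-- One time step: all particles of the configuration branch and move independently. -/
def step (P : X → PMF X) (μ : X → PMF ℕ+) : List X → PMF (List X)
  | [] => PMF.pure []
  | x :: c => (offspring P μ x).bind fun l => (step P μ c).bind fun l' => PMF.pure (l ++ l')

/-- One time step of the branching Markov chain, as a Markov kernel on configurations. -/
def stepKernel (P : X → PMF X) (μ : X → PMF ℕ+) : Kernel (List X) (List X) where
  toFun c := (step P μ c).toMeasure
  measurable' := measurable_from_top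

instance (P : X → PMF X) (μ : X → PMF ℕ+) : IsMarkovKernel (stepKernel P μ) :=
  ⟨fun c => inferInstanceAs (IsProbabilityMeasure (step P μ c).toMeasure)⟩

open scoped Classical in
/-- The transition law with `x₀` made absorbing. -/
def freezeMove (x₀ : X) (P : X → PMF X) : X → PMF X :=
  fun x => if x = x₀ then PMF.pure x₀ else P x

open scoped Classical in
/-- The branching law with no splitting at `x₀`. -/
def freezeBranch (x₀ : X) (μ : X → PMF ℕ+) : X → PMF ℕ+ :=
  fun x => if x = x₀ then PMF.pure 1 else μ x

/-- The transition kernels of BMC* with origin `x₀`: the first step is that of the original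
process; from the second step on, particles at `x₀` are frozen. -/
def bmcStarKernel (P : X → PMF X) (μ : X → PMF ℕ+) (x₀ : X) :
    (n : ℕ) → Kernel (Π _ : Finset.Iic n, List X) (List X)
  | 0 => (stepKernel P μ).comap (fun u => u ⟨0, Finset.mem_Iic.2 le_rfl⟩) (measurable_pi_apply _)
  | n + 1 => (stepKernel (freezeMove x₀ P) (freezeBranch x₀ μ)).comap
      (fun u => u ⟨n + 1, Finset.mem_Iic.2 le_rfl⟩) (measurable_pi_apply _)

instance (P : X → PMF X) (μ : X → PMF ℕ+) (x₀ : X) (n : ℕ) :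
    IsMarkovKernel (bmcStarKernel P μ x₀ n) := by
  cases n <;> (unfold bmcStarKernel; infer_instance)

/-- The law of BMC* with origin `x₀`, started with one particle at `x`, on the space of sequences
of configurations. -/
def bmcStar (P : X → PMF X) (μ : X → PMF ℕ+) (x₀ x : X) : Measure (ℕ → List X) :=
  Kernel.traj (X := fun _ => List X) (bmcStarKernel P μ x₀) 0 (fun _ => [x])

open scoped Classical in
/-- `η(n, x₀)`: the number of particles at `x₀` at time `n`. -/
def eta (n : ℕ) (x₀ : X) (c : ℕ → List X) : ℕ := (c n).count x₀

/-- `ν(x₀) = lim_n η(n, x₀)`. It is written as a lower limit; the limit exists almost surely under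
BMC* with origin `x₀`, see `ae_tendsto_eta`. -/
def nu (x₀ : X) (c : ℕ → List X) : ℝ≥0∞ := liminf (fun n => (eta n x₀ c : ℝ≥0∞)) atTop

/-- `E_x ν(x₀)`. -/
def expNu (P : X → PMF X) (μ : X → PMF ℕ+) (x x₀ : X) : ℝ≥0∞ :=
  ∫⁻ c, nu x₀ c ∂(bmcStar P μ x₀ x)

end BMC

section Limit

variable {X : Type*}

open scoped Classical in
theorem count_le_of_mem_support_step (P : X → PMF X) (μ : X → PMF ℕ+) (x₀ : X) :
    ∀ c l : List X, l ∈ (step (freezeMove x₀ P) (freezeBranch x₀ μ) c).support →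
      c.count x₀ ≤ l.count x₀ := by
  intro c
  induction c with
  | nil => intro l _; simp
  | cons y c ih =>
    intro l hl
    simp only [step, PMF.mem_support_bind_iff, PMF.mem_support_pure_iff] at hl
    obtain ⟨a, ha, b, hb, rfl⟩ := hl
    have hbc := ih b hb
    rw [List.count_append, List.count_cons]
    by_cases hy : y = x₀
    · subst hy
      have : a = [y] := by
        simpa [offspring, freezeMove, freezeBranch, moves] using ha
      subst this
      simp
      omega
    · simp [hy]
      omega

/-- Under BMC* with origin `x₀` the sequence `η(n, x₀)` converges almost surely (it is nondecreasing
for `n ≥ 1`), so that `ν(x₀)` is its limit. -/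
theorem ae_tendsto_eta (P : X → PMF X) (μ : X → PMF ℕ+) (x₀ x : X) :
    ∀ᵐ c ∂(bmcStar P μ x₀ x),
      Tendsto (fun n => (eta n x₀ c : ℝ≥0∞)) atTop (nhds (nu x₀ c)) := by
  classical
  have key : ∀ n : ℕ, ∀ᵐ c ∂(bmcStar P μ x₀ x), eta (n + 1) x₀ c ≤ eta (n + 2) x₀ c := by
    intro n
    let κ : (n : ℕ) → Kernel (Π _ : Finset.Iic n, List X) (List X) := bmcStarKernel P μ x₀
    have hm : ∀ k, Measurable fun c : ℕ → List X => eta k x₀ c := fun k =>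
      (measurable_from_top (f := fun l : List X => l.count x₀)).comp (measurable_pi_apply k)
    have hS : MeasurableSet {c : ℕ → List X | eta (n + 1) x₀ c ≤ eta (n + 2) x₀ c} :=
      measurableSet_le (hm _) (hm _)
    have h1 : bmcStar P μ x₀ x = (Kernel.traj (X := fun _ => List X) κ (n + 1) ∘ₖ
        Kernel.partialTraj (X := fun _ => List X) κ 0 (n + 1)) (fun _ => [x]) := by
      rw [Kernel.traj_comp_partialTraj (Nat.zero_le _)]; rfl
    rw [h1]
    refine Kernel.ae_comp_of_ae_ae hS (Filter.Eventually.of_forall fun u => ?_)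
    have ha : ∀ᵐ c ∂(Kernel.traj (X := fun _ => List X) κ (n + 1) u),
        c (n + 1) = u ⟨n + 1, Finset.mem_Iic.2 le_rfl⟩ := by
      have h3 := congrArg (fun K => K u)
        (Kernel.traj_map_frestrictLe_of_le (X := fun _ => List X) (κ := κ) (le_refl (n + 1)))
      have h4 : ∀ᵐ v ∂((Kernel.traj (X := fun _ => List X) κ (n + 1)).map
          (Preorder.frestrictLe (n + 1)) u),
          v ⟨n + 1, Finset.mem_Iic.2 le_rfl⟩ = u ⟨n + 1, Finset.mem_Iic.2 le_rfl⟩ := by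
        rw [show (Kernel.traj (X := fun _ => List X) κ (n + 1)).map
          (Preorder.frestrictLe (n + 1)) u = _ from h3, Kernel.deterministic_apply]
        have hs : MeasurableSet ((fun v : (Π _ : Finset.Iic (n + 1), List X) =>
            v ⟨n + 1, Finset.mem_Iic.2 le_rfl⟩) ⁻¹' {u ⟨n + 1, Finset.mem_Iic.2 le_rfl⟩}) :=
          measurable_pi_apply _ MeasurableSpace.measurableSet_top
        refine (ae_dirac_iff hs).2 ?_
        rfl
      rw [Kernel.map_apply _ (by fun_prop)] at h4
      exact ae_of_ae_map (by fun_prop) h4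
    have hb : ∀ᵐ c ∂(Kernel.traj (X := fun _ => List X) κ (n + 1) u),
        (u ⟨n + 1, Finset.mem_Iic.2 le_rfl⟩).count x₀ ≤ (c (n + 2)).count x₀ := by
      have h5 : ∀ᵐ l ∂((Kernel.traj (X := fun _ => List X) κ (n + 1)).map
          (fun c => c (n + 1 + 1)) u),
          (u ⟨n + 1, Finset.mem_Iic.2 le_rfl⟩).count x₀ ≤ l.count x₀ := by
        rw [Kernel.map_traj_succ_self, ae_iff]
        change (step (freezeMove x₀ P) (freezeBranch x₀ μ)
          (u ⟨n + 1, Finset.mem_Iic.2 le_rfl⟩)).toMeasure _ = 0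
        rw [PMF.toMeasure_apply_eq_zero_iff _ MeasurableSpace.measurableSet_top,
          Set.disjoint_left]
        intro l hl hl'
        exact hl' (count_le_of_mem_support_step P μ x₀ _ l hl)
      rw [Kernel.map_apply _ (by fun_prop)] at h5
      exact ae_of_ae_map (f := fun c : ℕ → List X => c (n + 1 + 1))
        (measurable_pi_apply (n + 1 + 1)).aemeasurable h5
    filter_upwards [ha, hb] with c h6 h7
    rw [← h6] at h7
    unfold eta
    convert h7
  have h2 := ae_all_iff.2 key
  filter_upwards [h2] with c hc
  have hmono : Monotone fun n => (eta (n + 1) x₀ c : ℝ≥0∞) :=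
    monotone_nat_of_le_succ fun n => by exact_mod_cast hc n
  have ht := tendsto_atTop_iSup hmono
  have ht' := (tendsto_add_atTop_iff_nat (f := fun n => (eta n x₀ c : ℝ≥0∞)) 1).1 ht
  unfold nu
  rw [ht'.liminf_eq]
  exact ht'

end Limit

/-! ### The random environment -/

/-- The branching laws `μ = (μ_k)_{k ≥ 1}` with finite mean `∑ k μ_k`. -/
def BranchLaw : Type := {μ : PMF ℕ+ // ∑' k : ℕ+, ((k : ℕ) : ℝ≥0∞) * μ k < ∞}

instance instMeasurableSpaceBranchLaw : MeasurableSpace BranchLaw :=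
  inferInstanceAs (MeasurableSpace {μ : PMF ℕ+ // ∑' k : ℕ+, ((k : ℕ) : ℝ≥0∞) * μ k < ∞})

variable {G : Type*} [Group G] {S : Finset G}

/-- Realizations `(ω_x, μ_x)_{x ∈ G}` of the environment. -/
abbrev Env (S : Finset G) : Type _ := G → PMF S × BranchLaw

/-- The transition law `p_ω(x, y) = ω_x(x⁻¹ y)`. -/
def envMove (e : Env S) (x : G) : PMF G := PMF.map (fun s : S => x * (s : G)) (e x).1

/-- The branching law at `x`. -/
def envBranch (e : Env S) (x : G) : PMF ℕ+ := (e x).2.1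

/-- The law `Θ` of the environment: the product measure with one-dimensional marginal `Q × Q'`. -/
def envLaw (Q : Measure (PMF S)) (Q' : Measure BranchLaw) : Measure (Env S) :=
  Measure.infinitePi fun _ : G => Q.prod Q'

/-- If the steps that have positive probability everywhere generate `G` as a monoid, then the random
walk in the environment is irreducible. -/
theorem isIrreducible_envMove (e : Env S) (T : Set G) (hT : Submonoid.closure T = ⊤)
    (h : ∀ x, ∀ t ∈ T, ∃ s : S, (s : G) = t ∧ 0 < (e x).1 s) : IsIrreducible (envMove e) := by
  have key : ∀ g ∈ Submonoid.closure T, ∀ x, ∃ n, 0 < nStep (envMove e) n x (x * g) := by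
    intro g hg
    induction hg using Submonoid.closure_induction_left with
    | one => intro x; exact ⟨0, by simp [nStep]⟩
    | mul_left t ht g _ ih =>
      intro x
      obtain ⟨n, hn⟩ := ih (x * t)
      obtain ⟨s, rfl, hs⟩ := h x t ht
      refine ⟨n + 1, ?_⟩
      rw [nStep, PMF.apply_pos_iff, PMF.mem_support_bind_iff]
      refine ⟨x * s, ?_, ?_⟩
      · rw [envMove, PMF.mem_support_map_iff]
        exact ⟨s, (PMF.mem_support_iff _ _).2 hs.ne', rfl⟩
      · rw [← mul_assoc]
        exact (PMF.mem_support_iff _ _).2 hn.ne'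
  intro x y
  simpa using key (x⁻¹ * y) (hT ▸ Submonoid.mem_top _) x

end BRWRE

end

/-!
The expectation `E_x ν(x₀)` depends on the branching Markov chain only through the mean kernel
`N(x, y) = m_x p(x, y)`, where `m_x` is the mean number of offspring: it is the total `N`-weight of
the paths from `x` to `x₀` that stop at their first visit to `x₀` at a positive time
(`expNu_eq_iSup_returnWeight`). For an irreducible kernel, finiteness for `x = x₀` implies
finiteness for all `x` (`iSup_returnWeight_lt_top`).

Call a finite set `B` supercritical if for some `b ∈ B` the weight of the first returns to `b`
inside `B`, up to some bounded length, exceeds one. This is a property of the environment in `B`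
alone.

If almost surely no finite set is supercritical, then by monotone convergence the return weight of
every `x₀` is at most one (`exists_finset_one_lt_returnWeight`), and the first case holds.

Otherwise some fixed finite `B` is supercritical with positive probability. As `G` is infinite, `B`
has infinitely many disjoint translates, in which the environments are i.i.d. copies of the one in
`B`; by the second Borel-Cantelli lemma infinitely many of them are supercritical, almost surely
(`infinitePi_ae_frequently_block`). Given `x₀`, one of these does not contain `x₀`. There the weight
`u` of the first passages to `x₀` is positive and satisfies `u ≥ N u`, hence `u(b) ≥ F u(b)` with
`F > 1` the return weight of `b` in the block. So `u(b) = ∞`, and by irreducibility the return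
weight of `x₀` is infinite (`iSup_returnWeight_eq_top`).
-/

namespace BRWRE

/-! ### Expected numbers of first passages of a weighted kernel -/

section Weights

variable {X Y : Type*}

open scoped Classical in
/-- The total weight `∑ N(x, x₁) N(x₁, x₂) ⋯` of the paths from `x` to `x₀` of length at most `n`
that stop when they hit `x₀` for the first time; the path of length `0` counts for `x = x₀`. -/
noncomputable def hitWeight (N : X → X → ℝ≥0∞) (x₀ : X) : ℕ → X → ℝ≥0∞
  | 0, x => if x = x₀ then 1 else 0
  | n + 1, x => if x = x₀ then 1 else ∑' y, N x y * hitWeight N x₀ n y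

/-- The total weight of the paths from `x` to `x₀` of length at least `1` and at most `n + 1` that
stop when they hit `x₀` for the first time at a positive time. -/
noncomputable def returnWeight (N : X → X → ℝ≥0∞) (x₀ : X) (n : ℕ) (x : X) : ℝ≥0∞ :=
  ∑' y, N x y * hitWeight N x₀ n y

/-- Every point can be reached from every other one along steps of nonzero weight. -/
def WeightIrreducible (N : X → X → ℝ≥0∞) : Prop :=
  ∀ x y, Relation.ReflTransGen (fun a b => N a b ≠ 0) x y

@[simp]
lemma hitWeight_self (N : X → X → ℝ≥0∞) (x₀ : X) (n : ℕ) : hitWeight N x₀ n x₀ = 1 := by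
  cases n <;> simp [hitWeight]

lemma hitWeight_zero_of_ne (N : X → X → ℝ≥0∞) {x₀ x : X} (h : x ≠ x₀) :
    hitWeight N x₀ 0 x = 0 := by
  simp [hitWeight, h]

lemma hitWeight_succ_of_ne (N : X → X → ℝ≥0∞) {x₀ x : X} (n : ℕ) (h : x ≠ x₀) :
    hitWeight N x₀ (n + 1) x = returnWeight N x₀ n x := by
  simp [hitWeight, returnWeight, h]

lemma hitWeight_mono_weight {N N' : X → X → ℝ≥0∞} (h : ∀ x y, N x y ≤ N' x y) (x₀ : X) (n : ℕ) :
    ∀ x, hitWeight N x₀ n x ≤ hitWeight N' x₀ n x := by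
  induction n with
  | zero => intro x; exact le_rfl
  | succ n ih =>
    intro x
    rcases eq_or_ne x x₀ with rfl | hx
    · simp
    · rw [hitWeight_succ_of_ne _ _ hx, hitWeight_succ_of_ne _ _ hx]
      exact ENNReal.tsum_le_tsum fun y => mul_le_mul' (h x y) (ih y)

lemma returnWeight_mono_weight {N N' : X → X → ℝ≥0∞} (h : ∀ x y, N x y ≤ N' x y) (x₀ : X) (n : ℕ)
    (x : X) : returnWeight N x₀ n x ≤ returnWeight N' x₀ n x :=
  ENNReal.tsum_le_tsum fun y => mul_le_mul' (h x y) (hitWeight_mono_weight h x₀ n y)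

lemma hitWeight_le_succ (N : X → X → ℝ≥0∞) (x₀ : X) (n : ℕ) :
    ∀ x, hitWeight N x₀ n x ≤ hitWeight N x₀ (n + 1) x := by
  induction n with
  | zero =>
    intro x
    rcases eq_or_ne x x₀ with rfl | hx
    · simp
    · simp [hitWeight_zero_of_ne _ hx]
  | succ n ih =>
    intro x
    rcases eq_or_ne x x₀ with rfl | hx
    · simp
    · rw [hitWeight_succ_of_ne _ _ hx, hitWeight_succ_of_ne _ _ hx]
      exact ENNReal.tsum_le_tsum fun y => mul_le_mul' le_rfl (ih y)

lemma monotone_hitWeight (N : X → X → ℝ≥0∞) (x₀ x : X) :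
    Monotone fun n => hitWeight N x₀ n x :=
  monotone_nat_of_le_succ fun n => hitWeight_le_succ N x₀ n x

lemma iSup_hitWeight_of_ne (N : X → X → ℝ≥0∞) {x₀ x : X} (h : x ≠ x₀) :
    ⨆ n, hitWeight N x₀ n x = ⨆ n, returnWeight N x₀ n x := by
  rw [← (monotone_hitWeight N x₀ x).iSup_nat_add 1]
  exact iSup_congr fun n => hitWeight_succ_of_ne N n h

/-- The limiting weights of first passages satisfy the one-step equation of the kernel. -/
lemma iSup_returnWeight (N : X → X → ℝ≥0∞) (x₀ x : X) :
    ⨆ n, returnWeight N x₀ n x = ∑' y, N x y * ⨆ n, hitWeight N x₀ n y := by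
  have h : ∀ y, Monotone fun n => N x y * hitWeight N x₀ n y := fun y _ _ hnm =>
    mul_le_mul' le_rfl (monotone_hitWeight N x₀ y hnm)
  simp_rw [ENNReal.mul_iSup, returnWeight, ENNReal.tsum_eq_iSup_sum]
  rw [iSup_comm]
  exact iSup_congr fun s => (ENNReal.finsetSum_iSup_of_monotone h).symm

lemma iSup_hitWeight_pos {N : X → X → ℝ≥0∞} (hN : WeightIrreducible N) (x₀ x : X) :
    ⨆ n, hitWeight N x₀ n x ≠ 0 := by
  induction hN x x₀ using Relation.ReflTransGen.head_induction_on with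
  | refl => simp
  | @head a c h _ ih =>
    rcases eq_or_ne a x₀ with rfl | ha
    · simp
    · rw [iSup_hitWeight_of_ne N ha, iSup_returnWeight, Ne, ENNReal.tsum_eq_zero]
      exact fun h0 => mul_ne_zero h ih (h0 c)

/-- If the weight of the returns to `x₀` is finite, then so is the weight of the first passages to
`x₀` from any point `x`: a path from `x₀` to `x` can be cut at its last visit to `x₀`. -/
lemma iSup_returnWeight_lt_top {N : X → X → ℝ≥0∞} (hN : WeightIrreducible N) {x₀ : X}
    (h : ⨆ n, returnWeight N x₀ n x₀ < ∞) (x : X) : ⨆ n, returnWeight N x₀ n x < ∞ := by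
  induction hN x₀ x with
  | refl => exact h
  | @tail b c _ hbc ih =>
    rcases eq_or_ne c x₀ with rfl | hc
    · exact h
    · rw [iSup_returnWeight] at ih
      rw [← iSup_hitWeight_of_ne N hc, lt_top_iff_ne_top]
      intro htop
      have h1 := ENNReal.le_tsum (f := fun y => N b y * ⨆ n, hitWeight N x₀ n y) c
      simp only [htop, ENNReal.mul_top hbc] at h1
      exact absurd (top_le_iff.1 h1) ih.ne

/-- A function that is superharmonic along an embedded copy of the kernel `N'` dominates the
first-passage weights of `N'`, scaled by its value at the target. -/
lemma mul_hitWeight_le {N : X → X → ℝ≥0∞} {N' : Y → Y → ℝ≥0∞} {φ : Y → X}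
    (hφ : Function.Injective φ) (hN : ∀ a b, N' a b ≤ N (φ a) (φ b)) {u : X → ℝ≥0∞}
    (hu : ∀ a, ∑' z, N (φ a) z * u z ≤ u (φ a)) (b : Y) (n : ℕ) :
    ∀ a, hitWeight N' b n a * u (φ b) ≤ u (φ a) := by
  have key : ∀ (f : Y → ℝ≥0∞), (∀ a, f a * u (φ b) ≤ u (φ a)) → ∀ a,
      (∑' c, N' a c * f c) * u (φ b) ≤ u (φ a) := fun f hf a =>
    calc (∑' c, N' a c * f c) * u (φ b)
        = ∑' c, N' a c * (f c * u (φ b)) := by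
          rw [← ENNReal.tsum_mul_right]; exact tsum_congr fun c => mul_assoc _ _ _
      _ ≤ ∑' c, N (φ a) (φ c) * u (φ c) :=
          ENNReal.tsum_le_tsum fun c => mul_le_mul' (hN a c) (hf c)
      _ ≤ ∑' z, N (φ a) z * u z :=
          ENNReal.tsum_comp_le_tsum_of_injective hφ fun z => N (φ a) z * u z
      _ ≤ u (φ a) := hu a
  induction n with
  | zero =>
    intro a
    rcases eq_or_ne a b with rfl | ha
    · simp
    · simp [hitWeight_zero_of_ne _ ha]
  | succ n ih =>
    intro a
    rcases eq_or_ne a b with rfl | ha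
    · simp
    · rw [hitWeight_succ_of_ne _ _ ha]
      exact key _ ih a

lemma mul_returnWeight_le {N : X → X → ℝ≥0∞} {N' : Y → Y → ℝ≥0∞} {φ : Y → X}
    (hφ : Function.Injective φ) (hN : ∀ a b, N' a b ≤ N (φ a) (φ b)) {u : X → ℝ≥0∞}
    (hu : ∀ a, ∑' z, N (φ a) z * u z ≤ u (φ a)) (b : Y) (n : ℕ) :
    returnWeight N' b n b * u (φ b) ≤ u (φ b) :=
  calc returnWeight N' b n b * u (φ b)
      = ∑' c, N' b c * (hitWeight N' b n c * u (φ b)) := by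
        rw [returnWeight, ← ENNReal.tsum_mul_right]; exact tsum_congr fun c => mul_assoc _ _ _
    _ ≤ ∑' c, N (φ b) (φ c) * u (φ c) :=
        ENNReal.tsum_le_tsum fun c => mul_le_mul' (hN b c) (mul_hitWeight_le hφ hN hu b n c)
    _ ≤ ∑' z, N (φ b) z * u z :=
        ENNReal.tsum_comp_le_tsum_of_injective hφ fun z => N (φ b) z * u z
    _ ≤ u (φ b) := hu b

/-- A supercritical block that avoids `x₀` makes the weight of the returns to `x₀` infinite: the
weight `u` of the first passages to `x₀` is superharmonic on the block, so that `u` is at least the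
return weight of the block times `u` at `b`; as `u > 0`, it must be infinite there. -/
theorem iSup_returnWeight_eq_top {N : X → X → ℝ≥0∞} (hirr : WeightIrreducible N)
    {N' : Y → Y → ℝ≥0∞} {φ : Y → X} (hφ : Function.Injective φ)
    (hN : ∀ a b, N' a b ≤ N (φ a) (φ b)) {b : Y} {n : ℕ} (hb : 1 < returnWeight N' b n b)
    {x₀ : X} (hx₀ : ∀ a, φ a ≠ x₀) : ⨆ n, returnWeight N x₀ n x₀ = ∞ := by
  by_contra hfin
  have hu : ∀ a, ∑' z, N (φ a) z * ⨆ n, hitWeight N x₀ n z ≤ ⨆ n, hitWeight N x₀ n (φ a) :=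
    fun a => by rw [iSup_hitWeight_of_ne N (hx₀ a), iSup_returnWeight]
  have h1 := mul_returnWeight_le hφ hN hu b n
  have hpos := iSup_hitWeight_pos hirr x₀ (φ b)
  have hlt := iSup_returnWeight_lt_top hirr (lt_top_iff_ne_top.2 hfin) (φ b)
  rw [← iSup_hitWeight_of_ne N (hx₀ b)] at hlt
  have h2 := ENNReal.mul_lt_mul_left hpos hlt.ne hb
  rw [one_mul] at h2
  exact absurd h1 h2.not_ge

open scoped Classical in
/-- The kernel `N` with all steps out of the finite set `B` removed. -/
noncomputable def truncate (N : X → X → ℝ≥0∞) (B : Finset X) (x y : X) : ℝ≥0∞ :=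
  if y ∈ B then N x y else 0

lemma truncate_mono (N : X → X → ℝ≥0∞) {B B' : Finset X} (h : B ⊆ B') (x y : X) :
    truncate N B x y ≤ truncate N B' x y := by
  unfold truncate
  by_cases hy : y ∈ B
  · simp [hy, h hy]
  · simp [hy]

lemma tsum_truncate_mul (N : X → X → ℝ≥0∞) (B : Finset X) (x : X) (f : X → ℝ≥0∞) :
    ∑' y, truncate N B x y * f y = ∑ y ∈ B, N x y * f y := by
  rw [tsum_eq_sum (s := B) fun y hy => by simp [truncate, hy]]
  exact Finset.sum_congr rfl fun y hy => by simp [truncate, hy]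

lemma tsum_mul_le_iSup_truncate (N : X → X → ℝ≥0∞) (x : X) {f : X → ℝ≥0∞}
    {g : Finset X → X → ℝ≥0∞} (hg : ∀ y, Monotone fun B => g B y) (h : ∀ y, f y ≤ ⨆ B, g B y) :
    ∑' y, N x y * f y ≤ ⨆ B, ∑' y, truncate N B x y * g B y := by
  classical
  rw [ENNReal.tsum_eq_iSup_sum]
  refine iSup_le fun B => ?_
  calc ∑ y ∈ B, N x y * f y
      ≤ ∑ y ∈ B, ⨆ B', N x y * g B' y := Finset.sum_le_sum fun y _ => by
        rw [← ENNReal.mul_iSup]; exact mul_le_mul' le_rfl (h y)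
    _ = ⨆ B', ∑ y ∈ B, N x y * g B' y :=
        ENNReal.finsetSum_iSup_of_monotone fun y _ _ hB => mul_le_mul' le_rfl (hg y hB)
    _ ≤ ⨆ B, ∑' y, truncate N B x y * g B y := iSup_le fun B' => by
        refine le_trans ?_ (le_iSup _ (B ∪ B'))
        rw [tsum_truncate_mul]
        exact (Finset.sum_le_sum fun y _ => mul_le_mul' le_rfl
          (hg y Finset.subset_union_right)).trans
          (Finset.sum_le_sum_of_subset Finset.subset_union_left)

lemma hitWeight_le_iSup_truncate (N : X → X → ℝ≥0∞) (x₀ : X) (n : ℕ) :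
    ∀ x, hitWeight N x₀ n x ≤ ⨆ B, hitWeight (truncate N B) x₀ n x := by
  induction n with
  | zero => intro x; exact le_iSup (fun B => hitWeight (truncate N B) x₀ 0 x) ∅
  | succ n ih =>
    intro x
    rcases eq_or_ne x x₀ with rfl | hx
    · simp
    · simp_rw [hitWeight_succ_of_ne _ _ hx]
      exact tsum_mul_le_iSup_truncate N x
        (fun y _ _ hB => hitWeight_mono_weight (truncate_mono N hB) x₀ n y) ih

lemma hitWeight_truncate (N : X → X → ℝ≥0∞) (B : Finset X) (x₀ : B) (n : ℕ) :
    ∀ x : B, hitWeight (truncate N B) x₀ n x =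
      hitWeight (fun a b : B => N a b) x₀ n x := by
  induction n with
  | zero =>
    intro x
    rcases eq_or_ne x x₀ with rfl | hx
    · simp
    · rw [hitWeight_zero_of_ne _ hx, hitWeight_zero_of_ne _ (Subtype.coe_injective.ne hx)]
  | succ n ih =>
    intro x
    rcases eq_or_ne x x₀ with rfl | hx
    · simp
    · rw [hitWeight_succ_of_ne _ _ hx, hitWeight_succ_of_ne _ _ (Subtype.coe_injective.ne hx),
        returnWeight, returnWeight, tsum_truncate_mul, tsum_fintype, ← Finset.sum_coe_sort]
      exact Finset.sum_congr rfl fun y _ => by rw [ih y]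

/-- If the weight of the returns to `x₀` exceeds one, then this is already so for the restriction
of the kernel to some finite set. -/
lemma exists_finset_one_lt_returnWeight {N : X → X → ℝ≥0∞} {x₀ : X} {n : ℕ}
    (h : 1 < returnWeight N x₀ n x₀) :
    ∃ (B : Finset X) (b : B), 1 < returnWeight (fun x y : B => N x y) b n b := by
  classical
  have h1 : returnWeight N x₀ n x₀ ≤ ⨆ B, returnWeight (truncate N B) x₀ n x₀ :=
    tsum_mul_le_iSup_truncate N x₀
      (fun y _ _ hB => hitWeight_mono_weight (truncate_mono N hB) x₀ n y)
      (hitWeight_le_iSup_truncate N x₀ n)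
  obtain ⟨B, hB⟩ := lt_iSup_iff.1 (h.trans_le h1)
  refine ⟨insert x₀ B, ⟨x₀, Finset.mem_insert_self _ _⟩, ?_⟩
  refine (hB.trans_le (returnWeight_mono_weight
    (truncate_mono N (Finset.subset_insert x₀ B)) x₀ n x₀)).trans_eq ?_
  rw [returnWeight, returnWeight, tsum_truncate_mul, tsum_fintype, ← Finset.sum_coe_sort]
  exact Finset.sum_congr rfl fun y _ => by
    rw [← hitWeight_truncate N (insert x₀ B) ⟨x₀, Finset.mem_insert_self _ _⟩ n y]

end Weights

/-! ### First moments of one time step -/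

section FirstMoment

variable {X : Type*}

/-- The expectation of `f` under `p`. -/
noncomputable def pmfExp {α : Type*} (p : PMF α) (f : α → ℝ≥0∞) : ℝ≥0∞ := ∑' a, p a * f a

/-- The sum of `h` over the particles of a configuration. -/
def particleSum (h : X → ℝ≥0∞) (c : List X) : ℝ≥0∞ := (c.map h).sum

/-- The mean number of offspring. -/
noncomputable def meanOffspring (μ : PMF ℕ+) : ℝ≥0∞ := ∑' k : ℕ+, ((k : ℕ) : ℝ≥0∞) * μ k

/-- The expected number of children at `y` of a particle at `x`. -/
noncomputable def meanKernel (P : X → PMF X) (μ : X → PMF ℕ+) (x y : X) : ℝ≥0∞ :=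
  meanOffspring (μ x) * P x y

lemma pmfExp_pure {α : Type*} (a : α) (f : α → ℝ≥0∞) : pmfExp (PMF.pure a) f = f a := by
  rw [pmfExp, tsum_eq_single a fun b hb => by simp [PMF.pure_apply_of_ne _ _ hb]]
  simp

lemma pmfExp_bind {α β : Type*} (p : PMF α) (q : α → PMF β) (f : β → ℝ≥0∞) :
    pmfExp (p.bind q) f = pmfExp p fun a => pmfExp (q a) f := by
  simp_rw [pmfExp, PMF.bind_apply, ← ENNReal.tsum_mul_right, ← ENNReal.tsum_mul_left]
  rw [ENNReal.tsum_comm]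
  simp_rw [mul_assoc]

lemma pmfExp_add {α : Type*} (p : PMF α) (f g : α → ℝ≥0∞) :
    pmfExp p (fun a => f a + g a) = pmfExp p f + pmfExp p g := by
  simp_rw [pmfExp, mul_add]
  exact ENNReal.tsum_add

lemma pmfExp_const {α : Type*} (p : PMF α) (r : ℝ≥0∞) : pmfExp p (fun _ => r) = r := by
  rw [pmfExp, ENNReal.tsum_mul_right, p.tsum_coe, one_mul]

@[simp]
lemma particleSum_nil (h : X → ℝ≥0∞) : particleSum h [] = 0 := rfl

@[simp]
lemma particleSum_cons (h : X → ℝ≥0∞) (x : X) (c : List X) :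
    particleSum h (x :: c) = h x + particleSum h c := by
  simp [particleSum]

@[simp]
lemma particleSum_append (h : X → ℝ≥0∞) (c c' : List X) :
    particleSum h (c ++ c') = particleSum h c + particleSum h c' := by
  simp [particleSum]

lemma pmfExp_moves (p : PMF X) (h : X → ℝ≥0∞) (k : ℕ) :
    pmfExp (moves p k) (particleSum h) = k * pmfExp p h := by
  induction k with
  | zero => simp [moves, pmfExp_pure]
  | succ k ih =>
    simp_rw [moves, pmfExp_bind, pmfExp_pure, particleSum_cons, pmfExp_add, pmfExp_const, ih]
    push_cast
    ring

lemma pmfExp_offspring (P : X → PMF X) (μ : X → PMF ℕ+) (h : X → ℝ≥0∞) (x : X) :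
    pmfExp (offspring P μ x) (particleSum h) = meanOffspring (μ x) * pmfExp (P x) h := by
  simp_rw [offspring, pmfExp_bind, pmfExp_moves]
  rw [pmfExp, meanOffspring, ← ENNReal.tsum_mul_right]
  exact tsum_congr fun k => by ring

lemma pmfExp_step (P : X → PMF X) (μ : X → PMF ℕ+) (h : X → ℝ≥0∞) (c : List X) :
    pmfExp (step P μ c) (particleSum h) =
      particleSum (fun x => meanOffspring (μ x) * pmfExp (P x) h) c := by
  induction c with
  | nil => simp [step, pmfExp_pure]
  | cons x c ih =>
    simp_rw [step, pmfExp_bind, pmfExp_pure, particleSum_append, pmfExp_add, pmfExp_const, ih,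
      pmfExp_offspring, particleSum_cons]

lemma meanOffspring_pure_one : meanOffspring (PMF.pure 1) = 1 := by
  have := pmfExp_pure (1 : ℕ+) fun k => ((k : ℕ) : ℝ≥0∞)
  rw [PNat.one_coe, Nat.cast_one] at this
  rw [← this, pmfExp, meanOffspring]
  exact tsum_congr fun k => mul_comm _ _

lemma one_le_meanOffspring (μ : PMF ℕ+) : 1 ≤ meanOffspring μ := by
  rw [← μ.tsum_coe, meanOffspring]
  refine ENNReal.tsum_le_tsum fun k => le_mul_of_one_le_left' ?_
  exact_mod_cast k.pos

lemma meanOffspring_mul_pmfExp (P : X → PMF X) (μ : X → PMF ℕ+) (h : X → ℝ≥0∞) (x : X) :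
    meanOffspring (μ x) * pmfExp (P x) h = ∑' y, meanKernel P μ x y * h y := by
  simp_rw [pmfExp, meanKernel, ← ENNReal.tsum_mul_left, mul_assoc]

/-- One step of the process with frozen origin turns first-passage weights up to length `n` into
those up to length `n + 1`. -/
lemma pmfExp_step_freeze (P : X → PMF X) (μ : X → PMF ℕ+) (x₀ : X) (n : ℕ) (c : List X) :
    pmfExp (step (freezeMove x₀ P) (freezeBranch x₀ μ) c)
        (particleSum (hitWeight (meanKernel P μ) x₀ n)) =
      particleSum (hitWeight (meanKernel P μ) x₀ (n + 1)) c := by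
  rw [pmfExp_step]
  congr 1
  funext x
  rcases eq_or_ne x x₀ with rfl | hx
  · simp [freezeMove, freezeBranch, meanOffspring_pure_one, pmfExp_pure]
  · rw [hitWeight_succ_of_ne _ _ hx, returnWeight, ← meanOffspring_mul_pmfExp]
    simp [freezeMove, freezeBranch, hx]

lemma eta_eq_particleSum (N : X → X → ℝ≥0∞) (n : ℕ) (x₀ : X) (c : ℕ → List X) :
    (eta n x₀ c : ℝ≥0∞) = particleSum (hitWeight N x₀ 0) (c n) := by
  classical
  unfold eta
  generalize c n = l
  induction l with
  | nil => simp
  | cons y l ih =>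
    rw [particleSum_cons, ← ih, List.count_cons]
    by_cases hy : y = x₀ <;> simp [hitWeight, hy, add_comm]

end FirstMoment

/-! ### The expectation of `ν(x₀)` -/

section Expectation

variable {X : Type*}

instance : DiscreteMeasurableSpace (List X) := ⟨fun _ => MeasurableSpace.measurableSet_top⟩

lemma lintegral_toMeasure_eq_pmfExp [Countable X] (p : PMF (List X)) (f : List X → ℝ≥0∞) :
    ∫⁻ c, f c ∂p.toMeasure = pmfExp p f := by
  rw [lintegral_countable', pmfExp]
  refine tsum_congr fun c => ?_
  rw [PMF.toMeasure_apply_singleton _ _ (measurableSet_singleton c), mul_comm]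

/-- The joint law of the history up to time `n` and of the configuration at time `n + 1`. -/
lemma bmcStar_map_compProd (P : X → PMF X) (μ : X → PMF ℕ+) (x₀ x : X) (n : ℕ) :
    ((bmcStar P μ x₀ x).map (Preorder.frestrictLe n)) ⊗ₘ (bmcStarKernel P μ x₀ n) =
      (bmcStar P μ x₀ x).map (fun c => (Preorder.frestrictLe n c, c (n + 1))) := by
  have h := Kernel.partialTraj_compProd_eq_map_traj (X := fun _ => List X)
    (κ := bmcStarKernel P μ x₀) (Nat.zero_le n) (x₀ := fun _ => [x])
  rw [← Kernel.traj_map_frestrictLe_apply] at h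
  exact h

lemma lintegral_bmcStar_succ (P : X → PMF X) (μ : X → PMF ℕ+) (x₀ x : X) (n : ℕ)
    (f : List X → ℝ≥0∞) :
    ∫⁻ c, f (c (n + 1)) ∂(bmcStar P μ x₀ x) =
      ∫⁻ c, ∫⁻ l, f l ∂(bmcStarKernel P μ x₀ n (Preorder.frestrictLe n c))
        ∂(bmcStar P μ x₀ x) := by
  have : IsProbabilityMeasure (bmcStar P μ x₀ x) := by unfold bmcStar; infer_instance
  have hf : Measurable f := measurable_from_top
  have h := congrArg (fun ρ => ∫⁻ z, f z.2 ∂ρ) (bmcStar_map_compProd P μ x₀ x n)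
  rw [Measure.lintegral_compProd (by fun_prop), lintegral_map (by fun_prop) (by fun_prop),
    lintegral_map (by fun_prop) (by fun_prop)] at h
  exact h.symm

lemma bmcStar_zero (P : X → PMF X) (μ : X → PMF ℕ+) (x₀ x : X) :
    ∀ᵐ c ∂(bmcStar P μ x₀ x), c 0 = [x] := by
  have h : (bmcStar P μ x₀ x).map (Preorder.frestrictLe 0) = Measure.dirac fun _ => [x] := by
    have := Kernel.traj_map_frestrictLe_apply (X := fun _ => List X)
      (κ := bmcStarKernel P μ x₀) 0 0 (fun _ => [x])
    rw [Kernel.partialTraj_self, Kernel.id_apply] at this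
    exact this
  have h' : ∀ᵐ u ∂((bmcStar P μ x₀ x).map (Preorder.frestrictLe 0)),
      u ⟨0, Finset.mem_Iic.2 le_rfl⟩ = [x] := by
    rw [h, ae_dirac_iff]
    have hm : Measurable fun u : (Π _ : Finset.Iic 0, List X) =>
        u ⟨0, Finset.mem_Iic.2 le_rfl⟩ := by fun_prop
    exact hm (measurableSet_singleton [x])
  exact ae_of_ae_map (by fun_prop) h'

/-- From time `1` on, the particles at `x₀` are frozen, so that their number cannot decrease. -/
lemma ae_eta_le_succ (P : X → PMF X) (μ : X → PMF ℕ+) (x₀ x : X) (n : ℕ) :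
    ∀ᵐ c ∂(bmcStar P μ x₀ x), eta (n + 1) x₀ c ≤ eta (n + 2) x₀ c := by
  classical
  have : IsProbabilityMeasure (bmcStar P μ x₀ x) := by unfold bmcStar; infer_instance
  have hm : Measurable fun l : List X => l.count x₀ := measurable_from_top
  have hS : MeasurableSet {z : (Π _ : Finset.Iic (n + 1), List X) × List X |
      (z.1 ⟨n + 1, Finset.mem_Iic.2 le_rfl⟩).count x₀ ≤ z.2.count x₀} :=
    measurableSet_le (hm.comp ((measurable_pi_apply _).comp measurable_fst))
      (hm.comp measurable_snd)
  have h : ∀ᵐ z ∂((bmcStar P μ x₀ x).map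
      (fun c => (Preorder.frestrictLe (n + 1) c, c (n + 1 + 1)))),
      (z.1 ⟨n + 1, Finset.mem_Iic.2 le_rfl⟩).count x₀ ≤ z.2.count x₀ := by
    rw [← bmcStar_map_compProd, Measure.ae_compProd_iff hS]
    refine Eventually.of_forall fun u => ?_
    change ∀ᵐ l ∂(step (freezeMove x₀ P) (freezeBranch x₀ μ)
      (u ⟨n + 1, Finset.mem_Iic.2 le_rfl⟩)).toMeasure, _
    rw [ae_iff, PMF.toMeasure_apply_eq_zero_iff _ (.of_discrete), Set.disjoint_left]
    exact fun l hl hl' => hl' (by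
      convert count_le_of_mem_support_step P μ x₀ _ l hl)
  have h' := ae_of_ae_map (by fun_prop) h
  filter_upwards [h'] with c hc
  unfold eta
  change (c (n + 1)).count x₀ ≤ (c (n + 2)).count x₀ at hc
  convert hc

variable [Countable X]

/-- Each step after the first adds one to the length of the paths that the first-passage weight
counts; the first step, which moves particles away from `x₀` as well, turns it into a return
weight. -/
lemma lintegral_particleSum_bmcStar (P : X → PMF X) (μ : X → PMF ℕ+) (x₀ x : X) (n : ℕ) :
    ∀ k, ∫⁻ c, particleSum (hitWeight (meanKernel P μ) x₀ k) (c (n + 1)) ∂(bmcStar P μ x₀ x) =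
      returnWeight (meanKernel P μ) x₀ (k + n) x := by
  induction n with
  | zero =>
    intro k
    rw [lintegral_bmcStar_succ]
    have : IsProbabilityMeasure (bmcStar P μ x₀ x) := by unfold bmcStar; infer_instance
    have h : ∀ᵐ c ∂(bmcStar P μ x₀ x),
        ∫⁻ l, particleSum (hitWeight (meanKernel P μ) x₀ k) l
          ∂(bmcStarKernel P μ x₀ 0 (Preorder.frestrictLe 0 c)) =
        returnWeight (meanKernel P μ) x₀ (k + 0) x := by
      filter_upwards [bmcStar_zero P μ x₀ x] with c hc
      change ∫⁻ l, _ ∂(step P μ (c 0)).toMeasure = _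
      rw [lintegral_toMeasure_eq_pmfExp, hc, pmfExp_step, particleSum_cons, particleSum_nil,
        add_zero, meanOffspring_mul_pmfExp]
      rfl
    rw [lintegral_congr_ae h]
    simp
  | succ n ih =>
    intro k
    rw [lintegral_bmcStar_succ, show k + (n + 1) = (k + 1) + n by omega, ← ih (k + 1)]
    refine lintegral_congr fun c => ?_
    change ∫⁻ l, _ ∂(step (freezeMove x₀ P) (freezeBranch x₀ μ) (c (n + 1))).toMeasure = _
    rw [lintegral_toMeasure_eq_pmfExp, pmfExp_step_freeze]

/-- The first-moment formula: `E_x ν(x₀)` is the total weight, with respect to the mean kernel, of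
the paths from `x` to `x₀` that stop at their first visit to `x₀` at a positive time. -/
theorem expNu_eq_iSup_returnWeight (P : X → PMF X) (μ : X → PMF ℕ+) (x x₀ : X) :
    expNu P μ x x₀ = ⨆ n, returnWeight (meanKernel P μ) x₀ n x := by
  have hmeas : ∀ n, Measurable fun c : ℕ → List X => (eta n x₀ c : ℝ≥0∞) := fun n => by
    simp_rw [eta_eq_particleSum (meanKernel P μ)]
    exact (measurable_from_top (f := particleSum (hitWeight (meanKernel P μ) x₀ 0))).comp
      (measurable_pi_apply n)
  have hmono : ∀ᵐ c ∂(bmcStar P μ x₀ x), Monotone fun n => (eta (n + 1) x₀ c : ℝ≥0∞) := by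
    filter_upwards [ae_all_iff.2 (ae_eta_le_succ P μ x₀ x)] with c hc
    exact monotone_nat_of_le_succ fun n => by exact_mod_cast hc n
  have hnu : ∀ᵐ c ∂(bmcStar P μ x₀ x), nu x₀ c = ⨆ n, (eta (n + 1) x₀ c : ℝ≥0∞) := by
    filter_upwards [hmono, ae_tendsto_eta P μ x₀ x] with c hc ht
    exact tendsto_nhds_unique ((tendsto_add_atTop_iff_nat 1).2 ht) (tendsto_atTop_iSup hc)
  rw [expNu, lintegral_congr_ae hnu,
    lintegral_iSup_ae (fun n => hmeas (n + 1)) (by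
      intro n
      filter_upwards [hmono] with c hc using hc n.le_succ)]
  refine iSup_congr fun n => ?_
  simp_rw [eta_eq_particleSum (meanKernel P μ)]
  rw [lintegral_particleSum_bmcStar, zero_add]

end Expectation

/-! ### Independent translates of a finite block -/

section Blocks

/-- In an infinite group a finite set has infinitely many pairwise disjoint translates: injectivity
of `(i, b) ↦ g i * b` says that the sets `g i * B` are disjoint for different `i`. -/
lemma exists_seq_mul_injective {G : Type*} [Group G] [Infinite G] (B : Finset G) :
    ∃ g : ℕ → G, Function.Injective fun p : ℕ × B => g p.1 * (p.2 : G) := by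
  classical
  let r : G → G → Prop := fun g h => ∀ a ∈ B, ∀ b ∈ B, g * a ≠ h * b
  have : Std.Symm r := ⟨fun g h hgh a ha b hb heq => hgh b hb a ha heq.symm⟩
  obtain ⟨g, -, hg⟩ := exists_seq_of_forall_finset_exists' (fun _ : G => True) r fun s _ => by
    obtain ⟨y, hy⟩ := Infinite.exists_notMem_finset
      (((s ×ˢ B) ×ˢ B).image fun p => p.1.1 * p.1.2 * p.2⁻¹)
    refine ⟨y, trivial, fun x hx a ha b hb heq => hy (Finset.mem_image.2 ⟨((x, a), b), ?_, ?_⟩)⟩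
    · simp [hx, ha, hb]
    · simp [heq]
  refine ⟨g, fun ⟨i, a⟩ ⟨j, b⟩ h => ?_⟩
  rcases eq_or_ne i j with rfl | hij
  · exact Prod.ext rfl (Subtype.ext (mul_left_cancel h))
  · exact absurd h (hg hij a a.2 b b.2)

lemma countable_of_closure_eq_top {G : Type*} [Group G] (S : Finset G)
    (h : Subgroup.closure (S : Set G) = ⊤) : Countable G := by
  have hc : Countable (FreeGroup S) := inferInstanceAs (Countable (Quot _))
  have hs : Function.Surjective (FreeGroup.lift ((↑) : S → G)) := by
    rw [← MonoidHom.range_eq_top, FreeGroup.range_lift_eq_closure]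
    simpa using h
  exact hs.countable

/-- In an i.i.d. sequence an event of positive probability occurs infinitely often. -/
lemma infinitePi_ae_frequently {E : Type*} [MeasurableSpace E] (π : Measure E)
    [IsProbabilityMeasure π] {C : Set E} (hC : MeasurableSet C) (hpos : π C ≠ 0) :
    ∀ᵐ f ∂(Measure.infinitePi fun _ : ℕ => π), ∃ᶠ i in atTop, f i ∈ C := by
  set ρ := Measure.infinitePi fun _ : ℕ => π
  have hm : ∀ i, MeasurableSet {f : ℕ → E | f i ∈ C} := fun i => measurable_pi_apply i hC
  have hind : iIndepFun (fun (i : ℕ) (f : ℕ → E) => f i) ρ :=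
    iIndepFun_infinitePi (P := fun _ : ℕ => π) (X := fun _ e => e) fun _ => measurable_id
  have hset : iIndepSet (fun i => {f : ℕ → E | f i ∈ C}) ρ := by
    rw [iIndepSet_iff_meas_biInter hm]
    exact fun s => hind.measure_inter_preimage_eq_mul s (sets := fun _ => C) fun _ _ => hC
  have hprob : ∀ i, ρ {f : ℕ → E | f i ∈ C} = π C := fun i =>
    (measurePreserving_eval_infinitePi (fun _ : ℕ => π) i).measure_preimage hC.nullMeasurableSet
  have hlim := measure_limsup_eq_one hm hset (by
    simp_rw [hprob]
    exact ENNReal.tsum_const_eq_top_of_ne_zero hpos)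
  rw [← mem_ae_iff_prob_eq_one (MeasurableSet.measurableSet_limsup hm)] at hlim
  filter_upwards [hlim] with f hf
  rwa [mem_limsup_iff_frequently_mem] at hf

/-- Under a product measure with equal marginals, an event of positive probability that depends only
on the coordinates in the block `ψ` occurs in infinitely many of the disjoint blocks `φ (i, ·)`. -/
lemma infinitePi_ae_frequently_block {G M : Type*} [MeasurableSpace M] (θ : Measure M)
    [IsProbabilityMeasure θ] {B : Type*} {φ : ℕ × B → G} (hφ : Function.Injective φ)
    {ψ : B → G} (hψ : Function.Injective ψ) {C : Set (B → M)} (hC : MeasurableSet C)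
    (hpos : (Measure.infinitePi fun _ : G => θ) {e | (fun b => e (ψ b)) ∈ C} ≠ 0) :
    ∀ᵐ e ∂(Measure.infinitePi fun _ : G => θ), ∃ᶠ i in atTop, (fun b => e (φ (i, b))) ∈ C := by
  have hψm : Measurable fun (e : G → M) (b : B) => e (ψ b) := by fun_prop
  have h1 := Measure.map_infinitePi_infinitePi_of_inj (P := fun _ : G => θ) hψ
  have hpos' : (Measure.infinitePi fun _ : B => θ) C ≠ 0 := by
    rw [← h1, Measure.map_apply hψm hC]
    exact hpos
  have h2 := infinitePi_ae_frequently (Measure.infinitePi fun _ : B => θ) hC hpos'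
  rw [← Measure.infinitePi_map_curry (fun (_ : ℕ) (_ : B) => θ),
    ← Measure.map_infinitePi_infinitePi_of_inj (P := fun _ : G => θ) hφ,
    Measure.map_map (by fun_prop) (by fun_prop)] at h2
  exact ae_of_ae_map (f := MeasurableEquiv.curry ℕ B M ∘ fun (e : G → M) i => e (φ i))
    ((MeasurableEquiv.measurable _).comp (by fun_prop)).aemeasurable h2

end Blocks

/-! ### The mean kernel of the environment -/

section Environment

variable {G : Type*} [Group G] {S : Finset G}

/-- The expected number of children at `y` of a particle at `x`, when the environment at `x` is
`a`. -/
noncomputable def siteKernel (a : PMF S × BranchLaw) (x y : G) : ℝ≥0∞ :=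
  meanOffspring a.2.1 * PMF.map (fun s : S => x * (s : G)) a.1 y

lemma meanKernel_env (e : Env S) (x y : G) :
    meanKernel (envMove e) (envBranch e) x y = siteKernel (e x) x y := rfl

lemma siteKernel_mul_left (a : PMF S × BranchLaw) (g x y : G) :
    siteKernel a (g * x) (g * y) = siteKernel a x y := by
  classical
  simp only [siteKernel, PMF.map_apply, mul_assoc, mul_right_inj]

lemma measurable_pmf_apply {α : Type*} (a : α) : Measurable fun p : PMF α => p a :=
  (measurable_pi_apply a).comp (comap_measurable _)

lemma measurable_siteKernel (x y : G) :
    Measurable fun a : PMF S × BranchLaw => siteKernel a x y := by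
  classical
  have hb : Measurable fun l : BranchLaw => l.1 := measurable_subtype_coe
  unfold siteKernel meanOffspring
  simp only [PMF.map_apply]
  refine Measurable.mul ?_ ?_
  · exact Measurable.tsum fun k =>
      (((measurable_pmf_apply k).comp hb).comp measurable_snd).const_mul _
  · refine Measurable.tsum fun s => ?_
    split_ifs
    · exact (measurable_pmf_apply s).comp measurable_fst
    · exact measurable_const

/-- The mean kernel of the environment `f` on a finite block `B`, with all steps out of `B`
removed. -/
noncomputable def blockKernel (B : Finset G) (f : B → PMF S × BranchLaw) (x y : B) : ℝ≥0∞ :=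
  siteKernel (f x) x y

lemma measurable_returnWeight_blockKernel (B : Finset G) (b : B) (n : ℕ) (x : B) :
    Measurable fun f : B → PMF S × BranchLaw => returnWeight (blockKernel B f) b n x := by
  have hk : ∀ x y, Measurable fun f : B → PMF S × BranchLaw => blockKernel B f x y := fun x y =>
    (measurable_siteKernel (x : G) (y : G)).comp (measurable_pi_apply x)
  have hhit : ∀ n x, Measurable fun f : B → PMF S × BranchLaw =>
      hitWeight (blockKernel B f) b n x := by
    intro n
    induction n with
    | zero => intro x; exact measurable_const
    | succ n ih =>
      intro x
      rcases eq_or_ne x b with rfl | hx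
      · simp
      · simp_rw [hitWeight_succ_of_ne _ _ hx, returnWeight]
        exact Measurable.tsum fun y => (hk x y).mul (ih y)
  exact Measurable.tsum fun y => (hk x y).mul (hhit n y)

lemma weightIrreducible_meanKernel {X : Type*} {P : X → PMF X} (μ : X → PMF ℕ+)
    (h : IsIrreducible P) : WeightIrreducible (meanKernel P μ) := by
  have key : ∀ n x y, nStep P n x y ≠ 0 →
      Relation.ReflTransGen (fun a b => meanKernel P μ a b ≠ 0) x y := by
    intro n
    induction n with
    | zero =>
      intro x y hxy
      rw [nStep, ← PMF.mem_support_iff, PMF.mem_support_pure_iff] at hxy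
      exact hxy ▸ Relation.ReflTransGen.refl
    | succ n ih =>
      intro x y hxy
      rw [nStep, ← PMF.mem_support_iff, PMF.mem_support_bind_iff] at hxy
      obtain ⟨z, hz, hzy⟩ := hxy
      refine Relation.ReflTransGen.head ?_ (ih z y hzy)
      exact mul_ne_zero (zero_lt_one.trans_le (one_le_meanOffspring _)).ne' hz
  intro x y
  obtain ⟨n, hn⟩ := h x y
  exact key n x y hn.ne'

end Environment

end BRWRE

/-! ### The dichotomy -/

open BRWRE in
theorem mainTheorem7 {G : Type*} [Group G] [Infinite G] (S : Finset G)
    (hSsymm : ∀ s ∈ S, s⁻¹ ∈ S) (hSgen : Subgroup.closure (S : Set G) = ⊤)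
    (Q : Measure (PMF S)) [IsProbabilityMeasure Q]
    (Q' : Measure BRWRE.BranchLaw) [IsProbabilityMeasure Q']
    (S' : Finset G) (hS'S : S' ⊆ S) (hS'gen : Subgroup.closure (S' : Set G) = ⊤)
    (hQ : ∃ γ : ℝ, 0 < γ ∧ ∀ᵐ q ∂Q, ∀ s : S, (s : G) ∈ S' → ENNReal.ofReal γ < q s)
    (hirr : ∀ᵐ e ∂(BRWRE.envLaw Q Q'), BRWRE.IsIrreducible (BRWRE.envMove e)) :
    Xor
      (∀ᵐ e ∂(BRWRE.envLaw Q Q'), ∀ x x₀ : G,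
        BRWRE.expNu (BRWRE.envMove e) (BRWRE.envBranch e) x x₀ < ∞)
      (∀ᵐ e ∂(BRWRE.envLaw Q Q'), ∀ x₀ : G,
        BRWRE.expNu (BRWRE.envMove e) (BRWRE.envBranch e) x₀ x₀ = ∞) := by
  have := countable_of_closure_eq_top S hSgen
  have : IsProbabilityMeasure (envLaw (G := G) Q Q') := by unfold envLaw; infer_instance
  simp_rw [expNu_eq_iSup_returnWeight]
  have hexcl : (∀ᵐ e ∂(envLaw Q Q'), ∀ x x₀ : G,
        ⨆ n, returnWeight (meanKernel (envMove e) (envBranch e)) x₀ n x < ∞) →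
      ¬ ∀ᵐ e ∂(envLaw Q Q'), ∀ x₀ : G,
        ⨆ n, returnWeight (meanKernel (envMove e) (envBranch e)) x₀ n x₀ = ∞ := by
    intro h1 h2
    obtain ⟨e, he1, he2⟩ := (h1.and h2).exists
    exact (he1 1 1).ne (he2 1)
  suffices h : _ ∨ _ from h.elim (fun h => Or.inl ⟨h, hexcl h⟩)
    (fun h => Or.inr ⟨h, fun h' => hexcl h' h⟩)
  -- Either some finite block is supercritical with positive probability, or almost surely none is.
  by_cases hsuper : ∃ (B : Finset G) (b : B) (n : ℕ), envLaw Q Q'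
      {e | (fun x : B => e x) ∈ {f | 1 < returnWeight (blockKernel B f) b n b}} ≠ 0
  · right
    obtain ⟨B, b, n, hpos⟩ := hsuper
    obtain ⟨g, hg⟩ := exists_seq_mul_injective B
    have hC : MeasurableSet
        {f : B → PMF S × BranchLaw | 1 < returnWeight (blockKernel B f) b n b} :=
      measurableSet_lt measurable_const (measurable_returnWeight_blockKernel B b n b)
    have hfreq := infinitePi_ae_frequently_block (Q.prod Q') hg Subtype.coe_injective hC hpos
    filter_upwards [hirr, hfreq] with e he hfe x₀
    -- The translates are disjoint, so at most one of them contains `x₀`.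
    have hev : ∀ᶠ i in atTop, ∀ a : B, g i * a ≠ x₀ := by
      by_cases hx : ∃ p : ℕ × B, g p.1 * p.2 = x₀
      · obtain ⟨p, hp⟩ := hx
        filter_upwards [eventually_gt_atTop p.1] with i hi a ha
        exact hi.ne' (congrArg Prod.fst (@hg (i, a) p (ha.trans hp.symm)))
      · exact Eventually.of_forall fun i a ha => hx ⟨(i, a), ha⟩
    obtain ⟨i, hi, hix⟩ := (hfe.and_eventually hev).exists
    refine iSup_returnWeight_eq_top (weightIrreducible_meanKernel _ he)
      (φ := fun a : B => g i * a) (fun a a' h => Subtype.ext (mul_left_cancel h)) ?_ hi hix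
    intro a a'
    rw [meanKernel_env, siteKernel_mul_left]
    rfl
  · left
    push Not at hsuper
    have hsub : ∀ᵐ e ∂(envLaw Q Q'), ∀ (B : Finset G) (b : B) (n : ℕ),
        ¬ 1 < returnWeight (blockKernel B fun x : B => e x) b n b := by
      simp_rw [ae_all_iff]
      intro B b n
      rw [ae_iff]
      simpa using hsuper B b n
    filter_upwards [hirr, hsub] with e he hs x x₀
    refine iSup_returnWeight_lt_top (weightIrreducible_meanKernel _ he) ?_ x
    -- Without supercritical blocks the weight of the returns to `x₀` is at most one.
    refine (iSup_le fun n => ?_).trans_lt ENNReal.one_lt_top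
    by_contra! hn
    obtain ⟨B, b, hB⟩ := exists_finset_one_lt_returnWeight hn
    exact hs B b n hB
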